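/- Let $\mu$ be a strong limit singular cardinal, let $\lambda=\mu^+$, and let $S$ be a stationary subset of $\{\delta<\lambda:\operatorname{cf}(\delta)=\operatorname{cf}(\mu)\}$. For a set $C$ of ordinals let $\operatorname{nacc}(C)=\{\alpha\in C:\sup(C\cap\alpha)<\alpha\}$ and $\operatorname{acc}(C)=C\setminus\operatorname{nacc}(C)$. A pair $(\bar C,\bar I)$ with $\bar C=\langle C_\delta:\delta\in S\rangle$ and $\bar I=\langle I_\delta:\delta\in S\rangle$ is an *$S$-fair pair* if 1. $C_\delta$ is a closed unbounded subset of $\delta$ for each $\delta\in S$; 2. for each $\delta\in S$, $I_\delta$ is the ideal on $C_\delta$ generated by the sets $\{\gamma\in C_\delta:\gamma\in\operatorname{acc}(C_\delta)\text{ or }\operatorname{cf}(\gamma)<\alpha\text{ or }\gamma<\beta\}$ for $\alpha<\mu$ and $\beta<\delta$; 3. for every closed unbounded $E\subseteq\lambda$, the set $\{\delta\in S:E\cap C_\delta\notin I_\delta\}$ is stationary in $\lambda$. The ideal $\operatorname{id}_p(\bar C,\bar I)$ consists of all $A\subseteq\lambda$ such that, for some closed unbounded $E\subseteq\lambda$,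 $E\cap A\cap C_\delta\in I_\delta$ for every $\delta\in S\cap E$. It is *weakly $\mu$-saturated* if there is no function $\pi:\lambda\to\mu$ such that $\pi^{-1}(i)\notin\operatorname{id}_p(\bar C,\bar I)$ for all $i<\mu$. **Theorem.** Let $(\bar C,\bar I)$ be an $S$-fair pair. If $\operatorname{id}_p(\bar C,\bar I)$ is weakly $\mu$-saturated, then every stationary subset $T$ of $\{\delta<\lambda:\operatorname{cf}(\delta)\neq\operatorname{cf}(\mu)\}$ reflects, that is, there is an ordinal $\delta<\lambda$ of uncountable cofinality such that $T\cap\delta$ is stationary in $\delta$. -/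

import Mathlib

universe u

namespace ClubGuessing

open Set Order

/-- `E` is a closed unbounded subset of the ordinal `δ`, where `δ` is identified with the set of
ordinals below it: `E` consists of ordinals below `δ`, is unbounded in `δ`, and contains every
ordinal below `δ` that is the supremum of a nonempty subset of `E`. -/
def IsClubIn (E : Set Ordinal.{u}) (δ : Ordinal.{u}) : Prop :=
  E ⊆ Iio δ ∧ IsClub ((fun x : Iio δ => (x : Ordinal.{u})) ⁻¹' E)

/-- `T ∩ δ` is a stationary subset of the ordinal `δ`: it meets every closed unbounded subset
of `δ`. -/
def IsStationaryIn (T : Set Ordinal.{u}) (δ : Ordinal.{u}) : Prop :=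
  ∀ E : Set Ordinal.{u}, IsClubIn E δ → (T ∩ E).Nonempty

/-- A set `T` of ordinals below `l` reflects: for some ordinal `δ < l` of uncountable cofinality,
`T ∩ δ` is stationary in `δ`. -/
def Reflects (T : Set Ordinal.{u}) (l : Ordinal.{u}) : Prop :=
  ∃ δ < l, Cardinal.aleph0 < δ.cof ∧ IsStationaryIn T δ

/-- The non-accumulation points of `C`: those `α ∈ C` with `sup (C ∩ α) < α`
(the supremum of the empty set of ordinals is `0`). -/
def nacc (C : Set Ordinal.{u}) : Set Ordinal.{u} :=
  {α | α ∈ C ∧ sSup (C ∩ Iio α) < α}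

/-- The accumulation points of `C` that belong to `C`. -/
def acc (C : Set Ordinal.{u}) : Set Ordinal.{u} :=
  C \ nacc C

/-- `J` is a (not necessarily proper) ideal of subsets of `X`. -/
structure IsIdealOn (X : Set Ordinal.{u}) (J : Set (Set Ordinal.{u})) : Prop where
  subset : ∀ A ∈ J, A ⊆ X
  empty_mem : ∅ ∈ J
  mem_of_subset : ∀ A ∈ J, ∀ B, B ⊆ A → B ∈ J
  union_mem : ∀ A ∈ J, ∀ B ∈ J, A ∪ B ∈ J

/-- The ideal on `X` generated by a family `G` of subsets of `X`: the intersection of all ideals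
on `X` that contain `G`. -/
def generatedIdeal (X : Set Ordinal.{u}) (G : Set (Set Ordinal.{u})) : Set (Set Ordinal.{u}) :=
  {A | ∀ J : Set (Set Ordinal.{u}), IsIdealOn X J → G ⊆ J → A ∈ J}

/-- The sets `{γ ∈ C : γ ∈ acc C or cf γ < α or γ < β}` for ordinals `α < μ` and `β < δ`. -/
def fairGenerators (μ : Cardinal.{u}) (C : Set Ordinal.{u}) (δ : Ordinal.{u}) :
    Set (Set Ordinal.{u}) :=
  {A | ∃ α < μ.ord, ∃ β < δ, A = {γ ∈ C | γ ∈ acc C ∨ γ.cof.ord < α ∨ γ < β}}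

/-- `⟨C δ : δ ∈ S⟩` is an `S`-club system. (Values of `C` outside `S` are irrelevant.) -/
def IsClubSystem (S : Set Ordinal.{u}) (C : Ordinal.{u} → Set Ordinal.{u}) : Prop :=
  ∀ δ ∈ S, IsClubIn (C δ) δ

/-- The ideal `id_p(C, I)` on `l`: the sets `A ⊆ l` such that for some closed unbounded `E ⊆ l`,
`E ∩ A ∩ C δ ∈ I δ` for all `δ ∈ S ∩ E`. -/
def idp (l : Ordinal.{u}) (S : Set Ordinal.{u}) (C : Ordinal.{u} → Set Ordinal.{u})
    (I : Ordinal.{u} → Set (Set Ordinal.{u})) : Set (Set Ordinal.{u}) :=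
  {A | A ⊆ Iio l ∧ ∃ E, IsClubIn E l ∧ ∀ δ ∈ S ∩ E, E ∩ A ∩ C δ ∈ I δ}

/-- `(C, I)` is an `S`-fair pair, for `S` a subset of the cardinal successor of `μ`. -/
structure IsFairPair (μ : Cardinal.{u}) (S : Set Ordinal.{u})
    (C : Ordinal.{u} → Set Ordinal.{u}) (I : Ordinal.{u} → Set (Set Ordinal.{u})) : Prop where
  clubSystem : IsClubSystem S C
  ideal_eq : ∀ δ ∈ S, I δ = generatedIdeal (C δ) (fairGenerators μ (C δ) δ)
  guesses : ∀ E, IsClubIn E (succ μ).ord →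
    IsStationaryIn {δ ∈ S | E ∩ C δ ∉ I δ} (succ μ).ord

/-- The family `J` of subsets of `X` is weakly `σ`-saturated: there is no function `π : X → σ`
all of whose fibres `π⁻¹(i)`, `i < σ`, lie outside `J`. -/
def WeaklySaturated (X : Set Ordinal.{u}) (J : Set (Set Ordinal.{u})) (σ : Cardinal.{u}) : Prop :=
  ¬ ∃ π : Ordinal.{u} → Ordinal.{u}, MapsTo π X (Iio σ.ord) ∧
    ∀ i < σ.ord, {x ∈ X | π x = i} ∉ J

end ClubGuessing

/-! Write λ = μ⁺. The fair-pair ideal is governed by decreasing sequences `X δ i` of length cf(μ)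
(`IsFairPair.exists_guessNull_iff`): A is null if, on a club, A eventually misses the tails of each
sequence. Hence a nonnull set split according to a function into a small set K (2^|K| < λ) has at
most cf(μ) pieces whose union is nonnull, and the ideal is indecomposable at regular θ < λ, θ ≠
cf(μ).

As μ is singular, weak μ-saturation localizes: some nonnull A has no α disjoint nonnull subsets, for
one α < μ (`exists_nullSaturated`). As μ is a strong limit, fewer than μ sets then represent every
set modulo null sets on A (`NullSaturated.exists_generating_partition`).

If T does not reflect, thin it to a stationary U of constant cofinality θ ≠ cf(μ), with cofinal
sequences c_δ. Below each x < λ these have pairwise disjoint tails, starting at g_x(δ)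
(`exists_disjoint_tails`). By indecomposability some ε_δ makes {x ∈ A : x > δ, g_x(δ) ≤ ε_δ}
nonnull. Fodor yields δ < δ' in U with the same representative and c_δ(ε_δ) = c_δ'(ε_δ'). The two
nonnull sets agree modulo null sets, so they share an x, whose disjoint tails are violated. -/

namespace ClubGuessing

open Set Order Cardinal Ordinal

/-! ### Clubs, diagonal intersections and pressing down -/

section Clubs

/-- Excluding `x = 0` in the closure clause matters: there the approximation condition would be
vacuous. -/
theorem isClubIn_iff {E : Set Ordinal.{u}} {δ : Ordinal.{u}} :
    IsClubIn E δ ↔ E ⊆ Iio δ ∧ (∀ a < δ, ∃ b ∈ E, a ≤ b) ∧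
      ∀ x < δ, x ≠ 0 → (∀ a < x, ∃ b ∈ E, a < b ∧ b < x) → x ∈ E := by
  refine and_congr_right fun hE => ?_
  constructor
  · rintro ⟨hc, hu⟩
    refine ⟨fun a ha => ?_, fun x hx h0 h => ?_⟩
    · obtain ⟨b, hb, hab⟩ := hu ⟨a, ha⟩
      exact ⟨b, hb, hab⟩
    · have key := @hc {y : Iio δ | (y : Ordinal) ∈ E ∧ y.1 < x} (fun y hy => hy.1)
        (by
          obtain ⟨b, hb, -, hbx⟩ := h 0 (pos_iff_ne_zero.2 h0)
          exact ⟨⟨b, hE hb⟩, hb, hbx⟩) (.of_linearOrder _) (a := ⟨x, hx⟩)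
        ⟨fun y hy => hy.2.le, fun y hy => by
          by_contra hlt
          obtain ⟨b, hb, hyb, hbx⟩ := h y.1 (not_le.1 hlt)
          exact (hy (a := ⟨b, hE hb⟩) ⟨hb, hbx⟩).not_gt hyb⟩
      exact key
  · rintro ⟨hu, hc⟩
    refine ⟨fun s hs hs0 _ x hx => ?_, fun a => ?_⟩
    · by_cases hxs : x ∈ s
      · exact hs hxs
      have hlt : ∀ y ∈ s, y < x := fun y hy => lt_of_le_of_ne (hx.1 hy) (fun h => hxs (h ▸ hy))
      refine hc x.1 x.2 ?_ fun a ha => ?_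
      · obtain ⟨y, hy⟩ := hs0
        exact ((zero_le (a := y.1)).trans_lt (hlt y hy)).ne'
      · by_contra hcon
        push Not at hcon
        have hub : (⟨a, ha.trans x.2⟩ : Iio δ) ∈ upperBounds s := fun y hy => by
          by_contra hya
          exact (hcon y.1 (hs hy) (not_le.1 hya)).not_gt (hlt y hy)
        exact (hx.2 hub).not_gt ha
    · obtain ⟨b, hb, hab⟩ := hu a.1 a.2
      exact ⟨⟨b, hE hb⟩, hb, hab⟩

variable {κ : Cardinal.{u}}

theorem cof_Iio_ord_of_isRegular (hκ : κ.IsRegular) :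
    Order.cof (Iio κ.ord) = Cardinal.lift.{u + 1} κ := by
  rw [Ordinal.cof_Iio, ← Ordinal.lift_cof, hκ.cof_ord]

theorem IsClubIn.iInter {ι : Type u} [Nonempty ι] (hκ : κ.IsRegular) (h0 : ℵ₀ < κ)
    (hι : #ι < κ) {E : ι → Set Ordinal.{u}} (hE : ∀ i, IsClubIn (E i) κ.ord) :
    IsClubIn (⋂ i, E i) κ.ord := by
  refine ⟨(iInter_subset _ (Classical.arbitrary ι)).trans (hE _).1, ?_⟩
  rw [preimage_iInter]
  refine IsClub.iInter ?_ ?_ fun i => (hE i).2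
  · rw [cof_Iio_ord_of_isRegular hκ, ← Cardinal.lift_aleph0.{u+1, u}]
    exact fun h => h0.ne' (Cardinal.lift_injective h)
  · rw [cof_Iio_ord_of_isRegular hκ, Cardinal.lift_lift, Cardinal.lift_lt]
    exact hι

theorem IsClubIn.inter (hκ : κ.IsRegular) (h0 : ℵ₀ < κ) {E F : Set Ordinal.{u}}
    (hE : IsClubIn E κ.ord) (hF : IsClubIn F κ.ord) : IsClubIn (E ∩ F) κ.ord := by
  have := IsClubIn.iInter (ι := ULift.{u} Bool) hκ h0 (by
    refine lt_of_lt_of_le ?_ h0.le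
    exact Cardinal.lt_aleph0_of_finite _) (E := fun b => cond b.down E F)
    (by rintro ⟨_ | _⟩ <;> simpa)
  convert this using 1
  ext x
  simp [ULift.forall, and_comm]

theorem succ_lt_ord (hκ : ℵ₀ ≤ κ) {a : Ordinal.{u}} (ha : a < κ.ord) : a + 1 < κ.ord :=
  (Cardinal.isSuccLimit_ord hκ).succ_lt ha

theorem isClubIn_Ioo (hκ : κ.IsRegular) {a : Ordinal.{u}} (ha : a < κ.ord) :
    IsClubIn (Ioo a κ.ord) κ.ord := by
  rw [isClubIn_iff]
  refine ⟨fun x hx => hx.2, fun b hb => ⟨max (a + 1) b, ⟨?_, ?_⟩, le_max_right _ _⟩, ?_⟩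
  · exact (lt_add_one a).trans_le (le_max_left _ _)
  · exact max_lt (succ_lt_ord hκ.aleph0_le ha) hb
  · intro x hx h0 h
    obtain ⟨b, hb, -, hbx⟩ := h 0 (pos_iff_ne_zero.2 h0)
    exact ⟨hb.1.trans hbx, hx⟩

/-- The diagonal intersection of a family of clubs is a club. -/
theorem IsClubIn.diagonal (hκ : κ.IsRegular) (h0 : ℵ₀ < κ) {E : Ordinal.{u} → Set Ordinal.{u}}
    (hE : ∀ a < κ.ord, IsClubIn (E a) κ.ord) :
    IsClubIn {x | x < κ.ord ∧ ∀ a < x, x ∈ E a} κ.ord := by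
  rw [isClubIn_iff]
  refine ⟨fun x hx => hx.1, fun a ha => ?_, fun x hx hx0 h => ⟨hx, fun a hax => ?_⟩⟩
  · have step : ∀ b : Iio κ.ord, ∃ c : Iio κ.ord, b < c ∧ ∀ a < b.1, c.1 ∈ E a := by
      rintro ⟨b, hb⟩
      -- The extra index `none` keeps the family nonempty when `b = 0`.
      have hcl : IsClubIn (Ioo b κ.ord ∩ ⋂ i : Option b.ToType,
          i.elim (Iio κ.ord) fun j => E (Ordinal.ToType.mk.symm j).1) κ.ord := by
        refine (isClubIn_Ioo hκ hb).inter hκ h0 (IsClubIn.iInter hκ h0 ?_ ?_)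
        · rw [Cardinal.mk_option, mk_toType]
          exact Cardinal.add_lt_of_lt hκ.aleph0_le (Cardinal.lt_ord.1 hb)
            (Cardinal.one_lt_aleph0.trans h0)
        · rintro (_ | j)
          · refine isClubIn_iff.2 ⟨subset_rfl, fun a ha => ⟨a, ha, le_rfl⟩, fun x hx _ _ => hx⟩
          · exact hE _ ((Ordinal.ToType.mk.symm j).2.trans hb)
      obtain ⟨c, hc, -⟩ := (isClubIn_iff.1 hcl).2.1 b hb
      refine ⟨⟨c, hc.1.2⟩, hc.1.1, fun a ha => ?_⟩
      have := mem_iInter.1 hc.2 (some (Ordinal.ToType.mk ⟨a, ha⟩))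
      simpa using this
    choose f hf hfE using step
    -- For each `b` below the supremum of the iterates, a tail of them lies in `E b`, hence so does
    -- the supremum.
    let g : ℕ → Iio κ.ord := fun n => f^[n] ⟨a, ha⟩
    have hg : ∀ n, g (n + 1) = f (g n) := fun n => Function.iterate_succ_apply' _ _ _
    have hmono : StrictMono g := strictMono_nat_of_lt_succ fun n => by rw [hg]; exact hf _
    have hsup : ⨆ n, (g n).1 < κ.ord := by
      apply Ordinal.lift_iSup_lt_of_lt_cof
      · rw [Ordinal.lift_uzero, hκ.cof_ord]; simpa using h0
      · exact fun n => (g n).2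
    have hlt : ∀ n, (g n).1 < ⨆ n, (g n).1 := fun n =>
      lt_of_lt_of_le (hmono (Nat.lt_succ_self n)) (Ordinal.le_iSup (fun n => (g n).1) (n + 1))
    refine ⟨⨆ n, (g n).1, ⟨hsup, fun b hb => ?_⟩, Ordinal.le_iSup (fun n => (g n).1) 0⟩
    obtain ⟨n, hn⟩ := Ordinal.lt_iSup_iff.1 hb
    refine (isClubIn_iff.1 (hE b (hb.trans hsup))).2.2 _ hsup ((hlt 0).ne_bot) fun d hd => ?_
    obtain ⟨m, hm⟩ := Ordinal.lt_iSup_iff.1 hd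
    refine ⟨(g (max m n + 1)).1, ?_, ?_, hlt _⟩
    · rw [hg]
      exact hfE _ _ (hn.trans_le (hmono.monotone (le_max_right m n)))
    · exact hm.trans (hmono (Nat.lt_succ_of_le (le_max_left m n)))
  · refine (isClubIn_iff.1 (hE a (hax.trans hx))).2.2 x hx hx0 fun c hc => ?_
    obtain ⟨b, hb, hcb, hbx⟩ := h (max a c) (max_lt hax hc)
    exact ⟨b, hb.2 a ((le_max_left _ _).trans_lt hcb), (le_max_right _ _).trans_lt hcb, hbx⟩

theorem IsStationaryIn.inter_isClubIn (hκ : κ.IsRegular) (h0 : ℵ₀ < κ) {T E : Set Ordinal.{u}}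
    (hT : IsStationaryIn T κ.ord) (hE : IsClubIn E κ.ord) : IsStationaryIn (T ∩ E) κ.ord :=
  fun F hF => by
    obtain ⟨x, hx, hxE, hxF⟩ := hT _ (hE.inter hκ h0 hF)
    exact ⟨x, ⟨hx, hxE⟩, hxF⟩

/-- Fodor's pressing down lemma. -/
theorem IsStationaryIn.exists_const (hκ : κ.IsRegular) (h0 : ℵ₀ < κ) {T : Set Ordinal.{u}}
    (hT : IsStationaryIn T κ.ord) {f : Ordinal.{u} → Ordinal.{u}} (hf : ∀ x ∈ T, f x < x) :
    ∃ c, IsStationaryIn {x ∈ T | f x = c} κ.ord := by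
  by_contra! hcon
  simp only [IsStationaryIn, not_forall] at hcon
  choose E hE hne using hcon
  obtain ⟨x, hxT, hx, hxE⟩ := hT _ (IsClubIn.diagonal hκ h0 fun a _ => hE a)
  exact hne (f x) ⟨x, ⟨hxT, rfl⟩, hxE _ (hf x hxT)⟩

theorem isClubIn_isSuccLimit (hκ : κ.IsRegular) (h0 : ℵ₀ < κ) :
    IsClubIn {x | x < κ.ord ∧ IsSuccLimit x} κ.ord := by
  have h := (IsClubIn.diagonal hκ h0 (E := fun a => Ioo (a + 1) κ.ord) fun a ha =>
    isClubIn_Ioo hκ (succ_lt_ord h0.le ha)).inter hκ h0 (isClubIn_Ioo hκ hκ.ord_pos)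
  convert h using 1
  ext x
  constructor
  · rintro ⟨hx, hl⟩
    exact ⟨⟨hx, fun a ha => ⟨hl.succ_lt (hl.succ_lt ha |> fun h => (lt_add_one a).trans h), hx⟩⟩,
      hl.bot_lt, hx⟩
  · rintro ⟨⟨hx, h⟩, h0, -⟩
    refine ⟨hx, ?_⟩
    rw [Ordinal.isSuccLimit_iff, Order.isSuccPrelimit_iff_succ_lt]
    exact ⟨h0.ne', fun a ha => (h a ha).1⟩

end Clubs

/-! ### The null ideal of a system of decreasing sequences -/

section NullIdeal

/-- Given sets `X δ i` for `δ ∈ S`, the set `A` is null if for some club `E` of `l`, every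
`δ ∈ S ∩ E` admits an index `i` such that `A ∩ E` misses `X δ i`. -/
def GuessNull {ι : Type u} (l : Ordinal.{u}) (S : Set Ordinal.{u})
    (X : Ordinal.{u} → ι → Set Ordinal.{u}) (A : Set Ordinal.{u}) : Prop :=
  ∃ E, IsClubIn E l ∧ ∀ δ ∈ S ∩ E, ∃ i, A ∩ E ∩ X δ i = ∅

variable {ι : Type u} {κ : Cardinal.{u}} {l : Ordinal.{u}} {S : Set Ordinal.{u}}
  {X : Ordinal.{u} → ι → Set Ordinal.{u}} {A B : Set Ordinal.{u}}

theorem GuessNull.mono (hB : GuessNull l S X B) (h : A ⊆ B) : GuessNull l S X A := by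
  obtain ⟨E, hE, hEB⟩ := hB
  refine ⟨E, hE, fun δ hδ => ?_⟩
  obtain ⟨i, hi⟩ := hEB δ hδ
  refine ⟨i, ?_⟩
  rw [← subset_empty_iff, ← hi]
  gcongr

theorem GuessNull.union [LinearOrder ι] (hκ : κ.IsRegular) (h0 : ℵ₀ < κ)
    (hX : ∀ δ, Antitone (X δ)) (hA : GuessNull κ.ord S X A) (hB : GuessNull κ.ord S X B) :
    GuessNull κ.ord S X (A ∪ B) := by
  obtain ⟨E, hE, hEA⟩ := hA
  obtain ⟨F, hF, hFB⟩ := hB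
  refine ⟨E ∩ F, hE.inter hκ h0 hF, fun δ hδ => ?_⟩
  obtain ⟨i, hi⟩ := hEA δ ⟨hδ.1, hδ.2.1⟩
  obtain ⟨j, hj⟩ := hFB δ ⟨hδ.1, hδ.2.2⟩
  refine ⟨max i j, ?_⟩
  rw [← subset_empty_iff]
  rintro x ⟨⟨hxA | hxB, hxE, hxF⟩, hx⟩
  · exact hi.subset ⟨⟨hxA, hxE⟩, hX δ (le_max_left i j) hx⟩
  · exact hj.subset ⟨⟨hxB, hxF⟩, hX δ (le_max_right i j) hx⟩

theorem guessNull_Iic [Nonempty ι] (hκ : κ.IsRegular) {b : Ordinal.{u}} (hb : b < κ.ord) :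
    GuessNull κ.ord S X (Iic b) := by
  refine ⟨_, isClubIn_Ioo hκ hb, fun δ _ => ⟨Classical.arbitrary ι, ?_⟩⟩
  rw [← subset_empty_iff]
  rintro x ⟨⟨hx, hx', -⟩, -⟩
  exact hx.not_gt hx'

/-- If `A` is the union of few pieces, then the union of at most `#ι` of the pieces
is not null. -/
theorem exists_small_preimage_not_guessNull (hκ : κ.IsRegular) (h0 : ℵ₀ < κ) {K : Type u}
    (hK : 2 ^ #K < κ) (g : Ordinal.{u} → K) (hA : ¬ GuessNull κ.ord S X A) :
    ∃ Z : Set K, #Z ≤ #ι ∧ ¬ GuessNull κ.ord S X (A ∩ g ⁻¹' Z) := by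
  by_contra! hcon
  choose! E hE hEZ using hcon
  refine hA ⟨⋂ Z : {Z : Set K // #Z ≤ #ι}, E Z.1, ?_, fun δ hδ => ?_⟩
  · have : Nonempty {Z : Set K // #Z ≤ #ι} := ⟨∅, by simp⟩
    refine IsClubIn.iInter hκ h0 ?_ fun Z => hE Z.1 Z.2
    exact (mk_subtype_le _).trans_lt (by rwa [mk_set])
  · by_contra! hne
    choose γ hγ using hne
    -- One point from each `X δ i` suffices to defeat all indices, and these points meet at most
    -- `#ι` pieces.
    have hZ : #(range fun i => g (γ i)) ≤ #ι := mk_range_le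
    obtain ⟨i, hi⟩ := hEZ _ hZ δ ⟨hδ.1, mem_iInter.1 hδ.2 ⟨_, hZ⟩⟩
    exact hi.subset ⟨⟨⟨(hγ i).1.1, i, rfl⟩, mem_iInter.1 (hγ i).1.2 ⟨_, hZ⟩⟩, (hγ i).2⟩

/-- A function between regular cardinals of different size is bounded on a cofinal set. -/
theorem exists_isCofinal_setOf_le [LinearOrder ι] {ν : Type u} [LinearOrder ν]
    (hι : Order.cof ι = #ι) (hν : Order.cof ν = #ν) (hne : #ι ≠ #ν) (s : ι → ν) :
    ∃ ε, IsCofinal {i | s i ≤ ε} := by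
  by_contra! hcon
  simp only [not_isCofinal_iff] at hcon
  choose b hb using hcon
  have h1 : IsCofinal (range b) := fun i => ⟨_, ⟨s i, rfl⟩, (hb (s i) i le_rfl).le⟩
  have h2 : IsCofinal (range s) := by
    by_contra hs
    obtain ⟨ε, hε⟩ := not_isCofinal_iff.1 hs
    exact (hb ε (b ε) (hε _ ⟨_, rfl⟩).le).false
  refine hne (le_antisymm ?_ ?_)
  · rw [← hι]; exact (cof_le h1).trans mk_range_le
  · rw [← hν]; exact (cof_le h2).trans mk_range_le

/-- The null ideal is indecomposable with respect to regular cardinals other than `#ι`. -/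
theorem exists_le_not_guessNull [LinearOrder ι] (hκ : κ.IsRegular) (h0 : ℵ₀ < κ)
    (hX : ∀ δ, Antitone (X δ)) {ν : Type u} [LinearOrder ν]
    (hι : Order.cof ι = #ι) (hν : Order.cof ν = #ν) (hne : #ι ≠ #ν) (hνκ : #ν < κ)
    (h : Ordinal.{u} → ν) (hA : ¬ GuessNull κ.ord S X A) :
    ∃ ε, ¬ GuessNull κ.ord S X {x ∈ A | h x ≤ ε} := by
  by_contra! hcon
  choose E hE hEε using hcon
  have : Nonempty ν := ⟨h 0⟩
  refine hA ⟨_, IsClubIn.iInter hκ h0 hνκ hE, fun δ hδ => ?_⟩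
  by_contra! hne'
  choose γ hγ using hne'
  obtain ⟨ε, hε⟩ := exists_isCofinal_setOf_le hι hν hne fun i => h (γ i)
  obtain ⟨i, hi⟩ := hEε ε δ ⟨hδ.1, mem_iInter.1 hδ.2 ε⟩
  obtain ⟨j, hj, hij⟩ := hε i
  exact hi.subset ⟨⟨⟨(hγ j).1.1, hj⟩, mem_iInter.1 (hγ j).1.2 ε⟩, hX δ hij (hγ j).2⟩

/-! ### Saturation and generating partitions -/

/-- `A` has no family of pairwise disjoint subsets, indexed by `α`, none of which is null. -/
def NullSaturated (l : Ordinal.{u}) (S : Set Ordinal.{u}) (X : Ordinal.{u} → ι → Set Ordinal.{u})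
    (A : Set Ordinal.{u}) (α : Type u) : Prop :=
  ¬ ∃ B : α → Set Ordinal.{u}, Pairwise (Function.onFun Disjoint B) ∧
    ∀ i, B i ⊆ A ∧ ¬ GuessNull l S X (B i)

/-- A maximal disjoint family of small index sets with nonnull preimage has at most `#α` members by
saturation. Its union works: a nonnull remainder would contain another small nonnull preimage,
contradicting maximality. -/
theorem NullSaturated.exists_small_cover (hκ : κ.IsRegular) (h0 : ℵ₀ < κ) {α : Type u}
    (hα : NullSaturated κ.ord S X A α) {K : Type u} (hK : 2 ^ #K < κ) (g : Ordinal.{u} → K) :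
    ∃ Z : Set K, #Z ≤ #α * #ι ∧ GuessNull κ.ord S X (A \ g ⁻¹' Z) := by
  obtain ⟨F, hF⟩ := zorn_subset {F : Set (Set K) | F.PairwiseDisjoint id ∧
      ∀ Z ∈ F, #Z ≤ #ι ∧ ¬ GuessNull κ.ord S X (A ∩ g ⁻¹' Z)} (by
    intro c hc hchain
    refine ⟨⋃₀ c, ⟨?_, ?_⟩, fun s hs => subset_sUnion_of_mem hs⟩
    · exact (pairwiseDisjoint_sUnion hchain.directedOn).2 fun s hs => (hc hs).1
    · rintro Z ⟨s, hs, hZ⟩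
      exact (hc hs).2 Z hZ)
  have hFα : #F ≤ #α := by
    by_contra! hlt
    obtain ⟨e⟩ := Cardinal.le_def α F |>.1 hlt.le
    refine hα ⟨fun i => A ∩ g ⁻¹' (e i).1, fun i j hij => ?_, fun i => ⟨inter_subset_left,
      (hF.prop.2 _ (e i).2).2⟩⟩
    have hd : Disjoint (e i).1 (e j).1 := hF.prop.1 (e i).2 (e j).2
      fun h => hij (e.injective (Subtype.ext h))
    exact (hd.preimage g).mono inter_subset_right inter_subset_right
  refine ⟨⋃₀ F, ?_, ?_⟩
  · refine (mk_sUnion_le F).trans ?_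
    gcongr
    exact ciSup_le' fun Z => (hF.prop.2 Z.1 Z.2).1
  · by_contra hn
    obtain ⟨Z, hZ, hZn⟩ := exists_small_preimage_not_guessNull hκ h0 hK g hn
    have hsub : A \ g ⁻¹' ⋃₀ F ∩ g ⁻¹' Z ⊆ A ∩ g ⁻¹' (Z \ ⋃₀ F) :=
      fun x hx => ⟨hx.1.1, hx.2, hx.1.2⟩
    have hpos : ¬ GuessNull κ.ord S X (A ∩ g ⁻¹' (Z \ ⋃₀ F)) := fun h => hZn (h.mono hsub)
    have hmem : Z \ ⋃₀ F ∈ F := by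
      refine hF.mem_of_prop_insert ⟨?_, ?_⟩
      · refine hF.prop.1.insert fun W hW _ => ?_
        exact disjoint_sdiff_left.mono_right (subset_sUnion_of_mem hW)
      · rintro W (rfl | hW)
        · exact ⟨(mk_le_mk_of_subset sdiff_subset).trans hZ, hpos⟩
        · exact hF.prop.2 W hW
    refine hZn ?_
    have : A \ g ⁻¹' ⋃₀ F ∩ g ⁻¹' Z = ∅ := by
      rw [← subset_empty_iff]
      exact fun x hx => hx.1.2 ⟨_, hmem, (hsub hx).2⟩
    rw [this]
    -- Were `∅` not null, the constant family `∅` would refute saturation.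
    exact (by
      by_contra h
      exact h ((hα ⟨fun _ => ∅, fun _ _ _ => disjoint_bot_left, fun _ => ⟨empty_subset _, h⟩⟩).elim))

/-- Under saturation, a single partition into few pieces generates all sets modulo null sets. -/
theorem NullSaturated.exists_generating_partition (hκ : κ.IsRegular) (h0 : ℵ₀ < κ) {α W : Type u}
    [LinearOrder W] [WellFoundedLT W] (hα : NullSaturated κ.ord S X A α)
    (hW : ℵ₀ ≤ Order.cof W) (hαW : #α * #ι < Order.cof W) (hWκ : 2 ^ (2 ^ #W : Cardinal) < κ) :
    ∃ f : Ordinal.{u} → Set W, ∀ C : Set Ordinal.{u}, ∃ Y : Set (Set W),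
      GuessNull κ.ord S X (A ∩ symmDiff C (f ⁻¹' Y)) := by
  by_contra! hcon
  choose F hF using hcon
  -- Recursively, `C w` is a set not generated, modulo null sets, by the partition that the earlier
  -- `C v` induce.
  let C : W → Set Ordinal.{u} := (wellFounded_lt (α := W)).fix
    fun w ih => F fun x => {v | ∃ h : v < w, x ∈ ih v h}
  have hC : ∀ w, C w = F fun x => {v | v < w ∧ x ∈ C v} := fun w => by
    have := (wellFounded_lt (α := W)).fix_eq (C := fun _ => Set Ordinal.{u})
      (fun w ih => F fun x => {v | ∃ h : v < w, x ∈ ih v h}) w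
    simpa only [exists_prop] using this
  let g : Ordinal.{u} → Set W := fun x => {w | x ∈ C w}
  obtain ⟨Z, hZ, hnull⟩ := hα.exists_small_cover hκ h0 (by rwa [mk_set]) g
  have hsep : ∀ p : Z × Z, ∃ w : W, p.1 ≠ p.2 → ¬ (w ∈ p.1.1 ↔ w ∈ p.2.1) := by
    rintro ⟨z, z'⟩
    by_cases h : z = z'
    · obtain ⟨w⟩ : Nonempty W := Order.cof_ne_zero_iff.1 (aleph0_pos.trans_le hW).ne'
      exact ⟨w, fun h' => (h' h).elim⟩
    · by_contra! hall
      exact h (Subtype.ext (Set.ext fun w => (hall w).2))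
  choose s hs using hsep
  -- Fewer than cof `W` coordinates separate the members of `Z`, so they are bounded by some `w`. On
  -- `g ⁻¹' Z`, the trace below `w` then determines membership in `C w`, contrary to its choice.
  obtain ⟨w, hw⟩ : ∃ w, ∀ y ∈ range s, y < w := by
    refine not_isCofinal_iff.1 fun hcof => ((cof_le hcof).trans mk_range_le).not_gt ?_
    rw [← Cardinal.mul_def]
    exact Cardinal.mul_lt_of_lt hW (hZ.trans_lt hαW) (hZ.trans_lt hαW)
  refine hF (fun x => {v | v < w ∧ x ∈ C v}) {y | ∃ z ∈ Z, w ∈ z ∧ y = {v | v < w ∧ v ∈ z}} ?_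
  rw [← hC]
  refine hnull.mono fun x hx => ⟨hx.1, fun hxZ => ?_⟩
  have hiff : x ∈ C w ↔ ∃ z ∈ Z, w ∈ z ∧ {v | v < w ∧ x ∈ C v} = {v | v < w ∧ v ∈ z} := by
    refine ⟨fun h => ⟨g x, hxZ, h, rfl⟩, fun ⟨z, hz, hwz, heq⟩ => ?_⟩
    by_cases hzg : g x = z
    · rw [← hzg] at hwz
      exact hwz
    · refine (hs (⟨g x, hxZ⟩, ⟨z, hz⟩) (fun h => hzg (congrArg Subtype.val h)) ?_).elim
      have h1 := Set.ext_iff.1 heq (s (⟨g x, hxZ⟩, ⟨z, hz⟩))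
      have h2 := hw _ ⟨(⟨g x, hxZ⟩, ⟨z, hz⟩), rfl⟩
      simp only [mem_ofPred_eq, h2, true_and] at h1
      exact h1
  rcases hx.2 with ⟨h1, h2⟩ | ⟨h1, h2⟩
  · exact h2 (hiff.1 h1)
  · exact h2 (hiff.2 h1)

/-- A weakly saturated null ideal is strongly saturated on some set that is not null. -/
theorem exists_nullSaturated {μ : Cardinal.{u}} (hμ : ℵ₀ ≤ μ) (hcof : μ.ord.cof < μ)
    (hl : ¬ GuessNull l S X univ)
    (hsat : ¬ ∃ π : Ordinal.{u} → Ordinal.{u}, (∀ x, π x < μ.ord) ∧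
      ∀ i < μ.ord, ¬ GuessNull l S X (π ⁻¹' {i})) :
    ∃ A, ¬ GuessNull l S X A ∧ ∃ α : Type u, #α < μ ∧ NullSaturated l S X A α := by
  by_contra! hcon
  simp only [NullSaturated, not_not] at hcon
  have hlim := Cardinal.isSuccLimit_ord hμ
  obtain ⟨a, ha⟩ := exists_isFundamentalSeq (o := μ.ord) rfl
  obtain ⟨B, hBd, hB⟩ := hcon univ hl μ.ord.cof.ord.ToType (by simpa)
  have hsub : ∀ i, #(a (Ordinal.ToType.mk.symm i)).1.ToType < μ := fun i => by
    rw [mk_toType]; exact Cardinal.lt_ord.1 (a _).2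
  -- Split into cf(μ) pieces, then the i-th piece into `a i` pieces, with `a` cofinal in μ. Labels
  -- repeat across different i, which only enlarges the fibres of `π`.
  choose D hDd hD using fun i => hcon (B i) (hB i).2 _ (hsub i)
  classical
  let π : Ordinal.{u} → Ordinal.{u} := fun x =>
    if h : ∃ i j, x ∈ D i j then (Ordinal.ToType.mk.symm h.choose_spec.choose).1 else 0
  have hπ : ∀ i j x, x ∈ D i j → π x = (Ordinal.ToType.mk.symm j).1 := by
    intro i j x hx
    have h : ∃ i j, x ∈ D i j := ⟨i, j, hx⟩
    have huniq : ∀ i' j', x ∈ D i' j' → (Ordinal.ToType.mk.symm j').1 =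
        (Ordinal.ToType.mk.symm j).1 := by
      intro i' j' hx'
      obtain rfl : i' = i := by
        by_contra hne
        exact (hBd hne).le_bot ⟨(hD i' j').1 hx', (hD i j).1 hx⟩
      obtain rfl : j' = j := by
        by_contra hne
        exact (hDd i' hne).le_bot ⟨hx', hx⟩
      rfl
    have hx' : π x = (Ordinal.ToType.mk.symm h.choose_spec.choose).1 := dif_pos h
    rw [hx']
    exact huniq _ _ h.choose_spec.choose_spec
  refine hsat ⟨π, fun x => ?_, fun η hη => ?_⟩
  · by_cases h : ∃ i j, x ∈ D i j
    · obtain ⟨i, j, hx⟩ := h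
      rw [hπ i j x hx]
      exact (Ordinal.ToType.mk.symm j).2.trans (a _).2
    · have : π x = 0 := dif_neg h
      rw [this]
      exact hlim.bot_lt
  · obtain ⟨_, ⟨i, rfl⟩, hi⟩ := ha.isCofinal_range ⟨η + 1, hlim.succ_lt hη⟩
    have hηa : η < (a i).1 := (lt_add_one η).trans_le hi
    intro hn
    obtain ⟨i, rfl⟩ := Ordinal.ToType.mk.symm.surjective i
    refine (hD i (Ordinal.ToType.mk ⟨η, hηa⟩)).2 (hn.mono fun x hx => ?_)
    simpa using hπ i _ x hx

end NullIdeal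

/-! ### From fair pairs to decreasing sequences -/

theorem aleph0_le_cof_iff_isSuccLimit {δ : Ordinal.{u}} : ℵ₀ ≤ δ.cof ↔ IsSuccLimit δ :=
  Ordinal.aleph0_le_cof_iff.trans Ordinal.one_lt_cof_iff

theorem mk_Iio_lt_of_ord_toType {θ : Cardinal.{u}} (i : θ.ord.ToType) : #(Iio i) < θ :=
  (mk_Iio_lt i (by simp)).trans_eq (mk_ord_toType θ)

theorem exists_strictMono_cofinal {δ : Ordinal.{u}} {θ : Cardinal.{u}} (h : δ.cof = θ) :
    ∃ c : θ.ord.ToType → Ordinal.{u}, StrictMono c ∧ (∀ i, c i < δ) ∧ ∀ a < δ, ∃ i, a ≤ c i := by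
  subst h
  obtain ⟨f, hf⟩ := exists_isFundamentalSeq (o := δ) rfl
  refine ⟨fun i => f (Ordinal.ToType.mk.symm i), fun i j hij =>
    hf.strictMono (Ordinal.ToType.mk.symm.strictMono hij), fun i => (f _).2, fun a ha => ?_⟩
  obtain ⟨_, ⟨i, rfl⟩, hi⟩ := hf.isCofinal_range ⟨a, ha⟩
  exact ⟨Ordinal.ToType.mk i, by simpa using! hi⟩

/-- The generators are directed: taking maxima of `α` and of `β` absorbs a union of two, so their
downward closure is already an ideal. -/
theorem mem_generatedIdeal_fairGenerators {μ : Cardinal.{u}} {C A : Set Ordinal.{u}}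
    {δ : Ordinal.{u}} (hμ : 0 < μ.ord) (hδ : 0 < δ) :
    A ∈ generatedIdeal C (fairGenerators μ C δ) ↔ ∃ α < μ.ord, ∃ β < δ,
      A ⊆ {γ ∈ C | γ ∈ acc C ∨ γ.cof.ord < α ∨ γ < β} := by
  constructor
  · intro h
    refine h {A | ∃ α < μ.ord, ∃ β < δ, A ⊆ {γ ∈ C | γ ∈ acc C ∨ γ.cof.ord < α ∨ γ < β}}
      ⟨?_, ⟨0, hμ, 0, hδ, empty_subset _⟩, ?_, ?_⟩ ?_
    · rintro A ⟨α, -, β, -, h⟩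
      exact h.trans fun x hx => hx.1
    · rintro A ⟨α, hα, β, hβ, h⟩ B hB
      exact ⟨α, hα, β, hβ, hB.trans h⟩
    · rintro A ⟨α, hα, β, hβ, h⟩ B ⟨α', hα', β', hβ', h'⟩
      refine ⟨max α α', max_lt hα hα', max β β', max_lt hβ hβ', ?_⟩
      rintro x (hx | hx)
      · obtain ⟨hxC, hx⟩ := h hx
        exact ⟨hxC, hx.imp_right (Or.imp (lt_max_of_lt_left) (lt_max_of_lt_left))⟩
      · obtain ⟨hxC, hx⟩ := h' hx
        exact ⟨hxC, hx.imp_right (Or.imp (lt_max_of_lt_right) (lt_max_of_lt_right))⟩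
    · rintro A ⟨α, hα, β, hβ, rfl⟩
      exact ⟨α, hα, β, hβ, subset_rfl⟩
  · rintro ⟨α, hα, β, hβ, h⟩ J hJ hG
    exact hJ.mem_of_subset _ (hG ⟨α, hα, β, hβ, rfl⟩) _ h

/-- The ideal of a fair pair is the ideal of null sets for suitable decreasing sequences
of length the cofinality of `μ`. -/
theorem IsFairPair.exists_guessNull_iff {μ : Cardinal.{u}} (hμ : ℵ₀ ≤ μ) {S : Set Ordinal.{u}}
    (hS : S ⊆ {δ | δ < (succ μ).ord ∧ δ.cof = μ.ord.cof}) {C : Ordinal.{u} → Set Ordinal.{u}}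
    {I : Ordinal.{u} → Set (Set Ordinal.{u})} (h : IsFairPair μ S C I) :
    ∃ X : Ordinal.{u} → μ.ord.cof.ord.ToType → Set Ordinal.{u}, (∀ δ, Antitone (X δ)) ∧
      ¬ GuessNull (succ μ).ord S X univ ∧
      ∀ A ⊆ Iio (succ μ).ord, A ∈ idp (succ μ).ord S C I ↔ GuessNull (succ μ).ord S X A := by
  have hlim := Cardinal.isSuccLimit_ord hμ
  have hμ0 : 0 < μ.ord := hlim.bot_lt
  obtain ⟨a, ha, haμ, hac⟩ := exists_strictMono_cofinal (δ := μ.ord) rfl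
  have hex : ∀ δ : Ordinal.{u}, ∃ c : μ.ord.cof.ord.ToType → Ordinal.{u}, StrictMono c ∧
      (δ ∈ S → (∀ i, c i < δ) ∧ ∀ b < δ, ∃ i, b ≤ c i) := by
    intro δ
    by_cases hδ : δ ∈ S
    · obtain ⟨c, hc, h1, h2⟩ := exists_strictMono_cofinal (hS hδ).2
      exact ⟨c, hc, fun _ => ⟨h1, h2⟩⟩
    -- Outside `S` any strictly increasing sequence will do; it only keeps `X δ` antitone.
    · exact ⟨a, ha, fun h => (hδ h).elim⟩
  choose c hc hcS using hex
  let X : Ordinal.{u} → μ.ord.cof.ord.ToType → Set Ordinal.{u} := fun δ i =>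
    {γ | γ ∈ C δ ∧ γ ∉ acc (C δ) ∧ a i ≤ γ.cof.ord ∧ c δ i ≤ γ}
  have hX : ∀ δ, Antitone (X δ) := fun δ i j hij γ hγ =>
    ⟨hγ.1, hγ.2.1, (ha.monotone hij).trans hγ.2.2.1, ((hc δ).monotone hij).trans hγ.2.2.2⟩
  have key : ∀ δ ∈ S, ∀ B, B ∩ C δ ∈ I δ ↔ ∃ i, B ∩ X δ i = ∅ := by
    intro δ hδ B
    have hδ0 : 0 < δ := by
      rw [pos_iff_ne_zero]
      rintro rfl
      have := (hS hδ).2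
      rw [Ordinal.cof_zero, eq_comm, Ordinal.cof_eq_zero] at this
      exact hμ0.ne' this
    rw [h.ideal_eq δ hδ, mem_generatedIdeal_fairGenerators hμ0 hδ0]
    constructor
    · rintro ⟨α, hα, β, hβ, hsub⟩
      obtain ⟨i, hi⟩ := hac α hα
      obtain ⟨j, hj⟩ := (hcS δ hδ).2 β hβ
      refine ⟨max i j, subset_empty_iff.1 ?_⟩
      rintro γ ⟨hγB, hγC, hγa, hγi, hγj⟩
      rcases (hsub ⟨hγB, hγC⟩).2 with h | h | h
      · exact hγa h
      · exact h.not_ge (hi.trans ((ha.monotone (le_max_left i j)).trans hγi))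
      · exact h.not_ge (hj.trans (((hc δ).monotone (le_max_right i j)).trans hγj))
    · rintro ⟨i, hi⟩
      refine ⟨a i, haμ i, c δ i, (hcS δ hδ).1 i, fun γ hγ => ⟨hγ.2, ?_⟩⟩
      by_contra! hcon
      exact hi.subset ⟨hγ.1, hγ.2, hcon⟩
  refine ⟨X, hX, ?_, fun A _ => ?_⟩
  · rintro ⟨E, hE, hEδ⟩
    obtain ⟨δ, ⟨hδ, hn⟩, hδE⟩ := h.guesses E hE E hE
    rw [key δ hδ] at hn
    exact hn (by simpa using hEδ δ ⟨hδ, hδE⟩)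
  · refine ⟨fun h => h.2.imp fun E hE => ⟨hE.1, fun δ hδ => ?_⟩, fun h => ⟨‹_›,
      h.imp fun E hE => ⟨hE.1, fun δ hδ => ?_⟩⟩⟩
    · simpa only [inter_comm A E] using (key δ hδ.1 _).1 (hE.2 δ hδ)
    · exact (key δ hδ.1 _).2 (by simpa only [inter_comm A E] using hE.2 δ hδ)

/-! ### Nonreflection and disjoint tails -/

/-- If `T` does not reflect at the limit ordinal `β`, then some unbounded subset of `β` is bounded
below every limit ordinal in `T ∩ β`. -/
theorem exists_unbounded_of_not_isStationaryIn {T : Set Ordinal.{u}} {β : Ordinal.{u}}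
    (hβ : IsSuccLimit β) (hTlim : ∀ δ ∈ T, IsSuccLimit δ)
    (hT : ℵ₀ < β.cof → ¬ IsStationaryIn T β) :
    ∃ e ⊆ Iio β, (∀ a < β, ∃ b ∈ e, a ≤ b) ∧
      ∀ δ ∈ T, δ < β → δ ∉ e ∧ ∃ l < δ, ∀ b ∈ e, b < δ → b ≤ l := by
  rcases (aleph0_le_cof_iff_isSuccLimit.2 hβ).lt_or_eq with hlt | heq
  · have := hT hlt
    simp only [IsStationaryIn, not_forall, not_nonempty_iff_eq_empty] at this
    obtain ⟨e, he, hTe⟩ := this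
    obtain ⟨h1, h2, h3⟩ := isClubIn_iff.1 he
    refine ⟨e, h1, h2, fun δ hδ hδβ => ?_⟩
    have hδe : δ ∉ e := fun h => hTe.subset ⟨hδ, h⟩
    refine ⟨hδe, ?_⟩
    by_contra! hcon
    refine hδe (h3 δ hδβ (hTlim δ hδ).ne_bot fun a ha => ?_)
    obtain ⟨b, hb, hbδ, hab⟩ := hcon a ha
    exact ⟨b, hb, hab, hbδ⟩
  · obtain ⟨f, hf, hfβ, hfc⟩ := exists_strictMono_cofinal heq.symm
    -- Successors avoid `T`, and only finitely many terms lie below a given δ < β.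
    refine ⟨range fun n => f n + 1, ?_, fun a ha => ?_, fun δ hδ hδβ => ⟨?_, ?_⟩⟩
    · rintro _ ⟨n, rfl⟩
      exact hβ.succ_lt (hfβ n)
    · obtain ⟨n, hn⟩ := hfc a ha
      exact ⟨_, ⟨n, rfl⟩, hn.trans (lt_add_one _).le⟩
    · rintro ⟨n, rfl⟩
      exact Order.not_isSuccLimit_succ (f n) (hTlim _ hδ)
    · obtain ⟨n, hn⟩ := hfc δ hδβ
      refine ⟨⨆ m : {m : Iio n // f m + 1 < δ}, f m.1.1 + 1, ?_, ?_⟩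
      · refine Ordinal.iSup_lt_of_lt_cof ?_ fun m => m.2
        refine ((mk_subtype_le _).trans_lt (mk_Iio_lt_of_ord_toType n)).trans_le ?_
        exact aleph0_le_cof_iff_isSuccLimit.2 (hTlim δ hδ)
      · rintro _ ⟨m, rfl⟩ hm
        have hmn : m < n := hf.lt_iff_lt.1 (((lt_add_one _).trans hm).trans_le hn)
        exact Ordinal.le_iSup (fun m : {m : Iio n // f m + 1 < δ} => f m.1.1 + 1) ⟨⟨m, hmn⟩, hm⟩

/-- Cofinal sequences in the elements of a nonreflecting set can be made disjoint below any given
point by removing initial segments. -/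
theorem exists_disjoint_tails {T : Set Ordinal.{u}} {l : Ordinal.{u}} {θ : Cardinal.{u}}
    (hθ : ℵ₀ ≤ θ) (hTθ : ∀ δ ∈ T, δ.cof = θ)
    (hT : ∀ β < l, ℵ₀ < β.cof → ¬ IsStationaryIn T β)
    {c : Ordinal.{u} → θ.ord.ToType → Ordinal.{u}} (hc : ∀ δ ∈ T, StrictMono (c δ))
    (hcδ : ∀ δ ∈ T, ∀ i, c δ i < δ) (hcc : ∀ δ ∈ T, ∀ a < δ, ∃ i, a ≤ c δ i)
    (β : Ordinal.{u}) (hβ : β < l) :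
    ∃ g : Ordinal.{u} → θ.ord.ToType, ∀ δ ∈ T, ∀ δ' ∈ T, δ < δ' → δ' < β →
      ∀ i ≥ g δ, ∀ j ≥ g δ', c δ i ≠ c δ' j := by
  have hTlim : ∀ δ ∈ T, IsSuccLimit δ := fun δ hδ => by
    rw [← aleph0_le_cof_iff_isSuccLimit, hTθ δ hδ]
    exact hθ
  obtain ⟨w⟩ : Nonempty θ.ord.ToType := by
    rw [← mk_ne_zero_iff, mk_ord_toType]
    exact (aleph0_pos.trans_le hθ).ne'
  have hcc' : ∀ δ ∈ T, ∀ a < δ, ∃ i, ∀ j ≥ i, a < c δ j := fun δ hδ a ha => by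
    obtain ⟨i, hi⟩ := hcc δ hδ _ ((hTlim δ hδ).succ_lt ha)
    exact ⟨i, fun j hj => (Order.succ_le_iff.1 hi).trans_le ((hc δ hδ).monotone hj)⟩
  induction β using WellFoundedLT.induction with
  | _ β ih =>
  rcases Ordinal.zero_or_succ_or_isSuccLimit β with rfl | ⟨β, rfl⟩ | hlim
  · exact ⟨fun _ => w, fun δ _ δ' _ _ h => (not_lt_zero h).elim⟩
  · obtain ⟨g, hg⟩ := ih β (lt_add_one β) ((lt_add_one β).trans hβ)
    have hs : ∀ δ, ∃ s : θ.ord.ToType, δ ∈ T → β ∈ T → δ < β → ∀ i ≥ s, ∀ j, c δ i ≠ c β j := by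
      intro δ
      by_cases h : δ ∈ T ∧ β ∈ T ∧ δ < β
      swap
      · exact ⟨w, fun h1 h2 h3 => (h ⟨h1, h2, h3⟩).elim⟩
      obtain ⟨hδ, hβT, hδβ⟩ := h
      obtain ⟨n, hn⟩ := hcc β hβT δ hδβ
      -- Fewer than `θ` = cf(δ) terms of `c β` lie below `δ`, so they are bounded there.
      obtain ⟨s, hs⟩ := hcc' δ hδ (⨆ m : {m : Iio n // c β m < δ}, c β m.1.1) (by
        refine Ordinal.iSup_lt_of_lt_cof ?_ fun m => m.2
        rw [hTθ δ hδ]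
        exact (mk_subtype_le _).trans_lt (mk_Iio_lt_of_ord_toType n))
      refine ⟨s, fun _ _ _ i hi j hij => ?_⟩
      have hjδ : c β j < δ := hij ▸ hcδ δ hδ i
      have hjn : j < n := (hc β hβT).lt_iff_lt.1 (hjδ.trans_le hn)
      refine (hs i hi).not_ge ?_
      rw [hij]
      exact Ordinal.le_iSup (fun m : {m : Iio n // c β m < δ} => c β m.1.1) ⟨⟨j, hjn⟩, hjδ⟩
    choose s hs using hs
    refine ⟨fun δ => max (g δ) (s δ), fun δ hδ δ' hδ' hlt hδ'β i hi j hj => ?_⟩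
    rcases (Order.lt_succ_iff.1 hδ'β).lt_or_eq with h | rfl
    · exact hg δ hδ δ' hδ' hlt h i ((le_max_left _ _).trans hi) j ((le_max_left _ _).trans hj)
    · exact hs δ hδ hδ' hlt i ((le_max_right _ _).trans hi) j
  · obtain ⟨e, heβ, heu, heT⟩ := exists_unbounded_of_not_isStationaryIn hlim hTlim (hT β hβ)
    have ih' : ∀ r, ∃ g : Ordinal.{u} → θ.ord.ToType, r < β → ∀ δ ∈ T, ∀ δ' ∈ T, δ < δ' → δ' < r →
        ∀ i ≥ g δ, ∀ j ≥ g δ', c δ i ≠ c δ' j := by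
      intro r
      by_cases hr : r < β
      · obtain ⟨g, hg⟩ := ih r hr (hr.trans hβ)
        exact ⟨g, fun _ => hg⟩
      · exact ⟨fun _ => w, fun h => (hr h).elim⟩
    choose G hG using ih'
    have ht : ∀ δ, ∃ t : θ.ord.ToType, δ ∈ T → δ < β → ∀ i ≥ t, ∀ b ∈ e, b < δ → b < c δ i := by
      intro δ
      by_cases h : δ ∈ T ∧ δ < β
      swap
      · exact ⟨w, fun h1 h2 => (h ⟨h1, h2⟩).elim⟩
      obtain ⟨m, hm, hml⟩ := (heT δ h.1 h.2).2
      obtain ⟨t, ht⟩ := hcc' δ h.1 m hm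
      exact ⟨t, fun _ _ i hi b hb hbδ => (hml b hb hbδ).trans_lt (ht i hi)⟩
    choose t ht using ht
    -- `r δ` names the block of `e` containing `δ`. Within a block the induction hypothesis applies;
    -- across blocks, `r δ` separates the sequence of `δ` from the tail of that of `δ'`.
    let r : Ordinal.{u} → Ordinal.{u} := fun δ => sInf {b ∈ e | δ < b}
    have hr : ∀ δ < β, r δ ∈ {b ∈ e | δ < b} := fun δ hδ => by
      obtain ⟨b, hb, hδb⟩ := heu _ (hlim.succ_lt hδ)
      exact csInf_mem ⟨b, hb, Order.succ_le_iff.1 hδb⟩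
    refine ⟨fun δ => max (G (r δ) δ) (t δ), fun δ hδ δ' hδ' hlt hδ'β i hi j hj => ?_⟩
    have hrδ := hr δ (hlt.trans hδ'β)
    have hrδ' := hr δ' hδ'β
    rcases lt_or_ge (r δ) δ' with h | h
    · have h1 := ht δ' hδ' hδ'β j ((le_max_right _ _).trans hj) _ hrδ.1 h
      exact (((hcδ δ hδ i).trans hrδ.2).trans h1).ne
    · have heq : r δ = r δ' := by
        refine le_antisymm (csInf_le' ⟨hrδ'.1, hlt.trans hrδ'.2⟩) (csInf_le' ⟨hrδ.1, ?_⟩)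
        refine lt_of_le_of_ne h fun h' => (heT δ' hδ' hδ'β).1 ?_
        rw [h']
        exact hrδ.1
      refine hG (r δ) (heβ hrδ.1) δ hδ δ' hδ' hlt (heq ▸ hrδ'.2) i ((le_max_left _ _).trans hi) j ?_
      rw [heq]
      exact (le_max_left _ _).trans hj

/-! ### Reflection from few representatives -/

theorem GuessNull.of_inter_Iio {ι : Type u} {l : Ordinal.{u}} {S A : Set Ordinal.{u}}
    {X : Ordinal.{u} → ι → Set Ordinal.{u}} (h : GuessNull l S X (A ∩ Iio l)) :
    GuessNull l S X A := by
  obtain ⟨E, hE, hEA⟩ := h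
  refine ⟨E, hE, fun δ hδ => ?_⟩
  obtain ⟨i, hi⟩ := hEA δ hδ
  refine ⟨i, subset_empty_iff.1 fun x hx => hi.subset ⟨⟨⟨hx.1.1, hE.1 hx.1.2⟩, hx.1.2⟩, hx.2⟩⟩

theorem IsStationaryIn.mono {T U : Set Ordinal.{u}} {l : Ordinal.{u}} (hT : IsStationaryIn T l)
    (h : T ⊆ U) : IsStationaryIn U l :=
  fun E hE => (hT E hE).mono (inter_subset_inter_left _ h)

/-- A stationary subset of `μ⁺` has a stationary subset that consists of limit ordinals
above `μ` of one fixed cofinality. -/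
theorem IsStationaryIn.exists_cof_eq {μ : Cardinal.{u}} (hμ : ℵ₀ ≤ μ) {T : Set Ordinal.{u}}
    (hT : IsStationaryIn T (succ μ).ord) :
    ∃ U ⊆ T, IsStationaryIn U (succ μ).ord ∧
      (∀ δ ∈ U, IsSuccLimit δ ∧ μ.ord < δ ∧ δ < (succ μ).ord) ∧
      ∃ θ : Cardinal.{u}, ∀ δ ∈ U, δ.cof = θ := by
  have hκ := isRegular_succ hμ
  have h0 : ℵ₀ < succ μ := hμ.trans_lt (lt_succ μ)
  have hμκ : μ.ord < (succ μ).ord := ord_lt_ord.2 (lt_succ μ)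
  have h1 := (hT.inter_isClubIn hκ h0 (isClubIn_isSuccLimit hκ h0)).inter_isClubIn hκ h0
    (isClubIn_Ioo hκ hμκ)
  obtain ⟨o, ho⟩ := h1.exists_const hκ h0 (f := fun δ => δ.cof.ord) (by
    rintro δ ⟨-, hδ⟩
    refine lt_of_le_of_lt (ord_le_ord.2 ?_) hδ.1
    exact (Ordinal.cof_le_card δ).trans (Order.lt_succ_iff.1 (Cardinal.lt_ord.1 hδ.2)))
  refine ⟨_, ?_, ho, ?_, o.card, ?_⟩
  · exact fun δ hδ => hδ.1.1.1
  · exact fun δ hδ => ⟨hδ.1.1.2.2, hδ.1.2⟩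
  · rintro δ ⟨-, hδ⟩
    rw [← hδ, card_ord]

/-- If few sets represent all sets modulo null sets, then every stationary set of points whose
cofinality differs from `#ι` reflects. -/
theorem reflects_of_generating_partition {μ : Cardinal.{u}} (hμ : ℵ₀ ≤ μ) {ι M : Type u}
    [LinearOrder ι] [Nonempty ι] (hι : Order.cof ι = #ι) {S A : Set Ordinal.{u}}
    {X : Ordinal.{u} → ι → Set Ordinal.{u}} (hX : ∀ δ, Antitone (X δ))
    (hA : ¬ GuessNull (succ μ).ord S X A) (hM : #M ≤ μ) (R : M → Set Ordinal.{u})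
    (hR : ∀ C, ∃ m, GuessNull (succ μ).ord S X (A ∩ symmDiff C (R m)))
    {T : Set Ordinal.{u}} (hT : ∀ δ ∈ T, δ.cof ≠ #ι) (hTstat : IsStationaryIn T (succ μ).ord) :
    Reflects T (succ μ).ord := by
  by_contra hrefl
  have hκ := isRegular_succ hμ
  have h0 : ℵ₀ < succ μ := hμ.trans_lt (lt_succ μ)
  obtain ⟨U, hUT, hU, hUlim, θ, hθ⟩ := hTstat.exists_cof_eq hμ
  obtain ⟨δ₀, hδ₀⟩ : U.Nonempty := (hU _ (isClubIn_isSuccLimit hκ h0)).mono inter_subset_left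
  have hθ0 : ℵ₀ ≤ θ := by
    rw [← hθ δ₀ hδ₀]
    exact aleph0_le_cof_iff_isSuccLimit.2 (hUlim δ₀ hδ₀).1
  have hθcof : Order.cof θ.ord.ToType = #θ.ord.ToType := by
    rw [cof_toType, mk_ord_toType, ← hθ δ₀ hδ₀, Ordinal.cof_ord_cof]
  have hθι : #ι ≠ #θ.ord.ToType := by
    rw [mk_ord_toType, ← hθ δ₀ hδ₀]
    exact (hT δ₀ (hUT hδ₀)).symm
  have hθκ : #θ.ord.ToType < succ μ := by
    rw [mk_ord_toType, ← hθ δ₀ hδ₀]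
    exact (Ordinal.cof_le_card _).trans_lt (Cardinal.lt_ord.1 (hUlim δ₀ hδ₀).2.2)
  have hc : ∀ δ : Ordinal.{u}, ∃ c : θ.ord.ToType → Ordinal.{u}, δ ∈ U →
      StrictMono c ∧ (∀ i, c i < δ) ∧ ∀ a < δ, ∃ i, a ≤ c i := by
    intro δ
    by_cases hδ : δ ∈ U
    · obtain ⟨c, hc⟩ := exists_strictMono_cofinal (hθ δ hδ)
      exact ⟨c, fun _ => hc⟩
    · exact ⟨fun _ => 0, fun h => (hδ h).elim⟩
  choose c hc using hc
  have hg := exists_disjoint_tails hθ0 hθ (fun β hβ hβ0 hst => hrefl ⟨β, hβ, hβ0, hst.mono hUT⟩)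
    (fun δ hδ => (hc δ hδ).1) (fun δ hδ => (hc δ hδ).2.1) (fun δ hδ => (hc δ hδ).2.2)
  have hne : Nonempty (Ordinal.{u} → θ.ord.ToType) := ⟨(hg 0 (hκ.ord_pos)).choose⟩
  choose! g hg using hg
  have hpos : ∀ δ < (succ μ).ord,
      ¬ GuessNull (succ μ).ord S X (A ∩ Ioi δ ∩ Iio (succ μ).ord) := fun δ hδ hn => by
    refine hA ((hn.of_inter_Iio.union hκ h0 hX (guessNull_Iic hκ hδ)).mono fun x hx => ?_)
    exact (lt_or_ge δ x).imp (fun h => ⟨hx, h⟩) id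
  have hε : ∀ δ, ∃ ε, δ < (succ μ).ord → ¬ GuessNull (succ μ).ord S X
      {x ∈ A ∩ Ioi δ ∩ Iio (succ μ).ord | g x δ ≤ ε} := by
    intro δ
    by_cases hδ : δ < (succ μ).ord
    · obtain ⟨ε, h⟩ := exists_le_not_guessNull hκ h0 hX hι hθcof hθι hθκ (fun x => g x δ)
        (hpos δ hδ)
      exact ⟨ε, fun _ => h⟩
    · exact ⟨g 0 0, fun h => (hδ h).elim⟩
  choose ε hε using hε
  choose m hm using fun δ => hR {x ∈ A ∩ Ioi δ ∩ Iio (succ μ).ord | g x δ ≤ ε δ}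
  obtain ⟨e⟩ : Nonempty (M ↪ μ.ord.ToType) := by
    -- Coding representatives by ordinals below μ makes them regressive on `U`, whose elements
    -- exceed μ.
    rw [← Cardinal.le_def, mk_ord_toType]
    exact hM
  obtain ⟨y, hy⟩ := hU.exists_const hκ h0
    (f := fun δ => (Ordinal.ToType.mk.symm (e (m δ))).1) fun δ hδ =>
      (Ordinal.ToType.mk.symm (e (m δ))).2.trans (hUlim δ hδ).2.1
  obtain ⟨z, hz⟩ := hy.exists_const hκ h0 (f := fun δ => c δ (ε δ)) fun δ hδ =>
    (hc δ hδ.1).2.1 _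
  obtain ⟨δ, ⟨⟨hδU, hδy⟩, hδz⟩, -⟩ := hz _ (isClubIn_isSuccLimit hκ h0)
  have hδ := (hUlim δ hδU).2.2
  obtain ⟨δ', ⟨⟨hδU', hδy'⟩, hδz'⟩, hlt, hδ'⟩ := hz _ (isClubIn_Ioo hκ hδ)
  have hmm : m δ' = m δ :=
    e.injective (Ordinal.ToType.mk.symm.injective (Subtype.ext (hδy'.trans hδy.symm)))
  -- The sets for `δ` and `δ'` are disjoint by the choice of tails, so the first is covered by the
  -- two null differences from the common representative.
  refine hε δ hδ ((((hm δ).union hκ h0 hX (hm δ'))).mono fun x hx => ?_)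
  by_cases hxR : x ∈ R (m δ)
  · refine Or.inr ⟨hx.1.1.1, Or.inr ⟨hmm ▸ hxR, fun hx' => ?_⟩⟩
    exact hg x hx.1.2 δ hδU δ' hδU' hlt hx'.1.1.2 (ε δ) hx.2 (ε δ') hx'.2 (hδz.trans hδz'.symm)
  · exact Or.inl ⟨hx.1.1.1, Or.inl ⟨hx, hxR⟩⟩

end ClubGuessing

theorem theorem6p6 (μ : Cardinal.{u}) (hsing : μ.IsSingular) (hlim : μ.IsStrongLimit)
    (S : Set Ordinal.{u})
    (hS : S ⊆ {δ | δ < (Order.succ μ).ord ∧ δ.cof = μ.ord.cof})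
    (hSstat : ClubGuessing.IsStationaryIn S (Order.succ μ).ord)
    (C : Ordinal.{u} → Set Ordinal.{u}) (I : Ordinal.{u} → Set (Set Ordinal.{u}))
    (hfair : ClubGuessing.IsFairPair μ S C I)
    (hsat : ClubGuessing.WeaklySaturated (Set.Iio (Order.succ μ).ord)
      (ClubGuessing.idp (Order.succ μ).ord S C I) μ)
    (T : Set Ordinal.{u})
    (hT : T ⊆ {δ | δ < (Order.succ μ).ord ∧ δ.cof ≠ μ.ord.cof})
    (hTstat : ClubGuessing.IsStationaryIn T (Order.succ μ).ord) :
    ClubGuessing.Reflects T (Order.succ μ).ord := by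
  open ClubGuessing Cardinal in
  have hμ : ℵ₀ ≤ μ := hsing.aleph0_le
  have hκ := isRegular_succ hμ
  have h0 : ℵ₀ < Order.succ μ := hμ.trans_lt (Order.lt_succ μ)
  have hlt2 : ∀ {x : Cardinal.{u}}, x < μ → 2 ^ x < μ := fun h => hlim.isStrongPrelimit h
  obtain ⟨X, hX, hX0, hXJ⟩ := hfair.exists_guessNull_iff hμ hS
  have hι : #μ.ord.cof.ord.ToType = μ.ord.cof := mk_ord_toType _
  have hne : Nonempty μ.ord.cof.ord.ToType := by
    rw [← mk_ne_zero_iff, hι]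
    exact mt Ordinal.cof_eq_zero.1 (isSuccLimit_ord hμ).ne_bot
  obtain ⟨A, hA, α, hαμ, hα⟩ := exists_nullSaturated hμ hsing.cof_ord_lt hX0 (by
    rintro ⟨π, hπ, hπn⟩
    refine hsat ⟨π, fun x _ => hπ x, fun i hi hmem => hπn i hi ?_⟩
    refine (((hXJ _ fun x hx => hx.1).1 hmem).mono ?_).of_inter_Iio
    exact fun x hx => ⟨hx.2, hx.1⟩)
  have hν : max ℵ₀ (#α * #μ.ord.cof.ord.ToType) < μ := by
    have h1 : ℵ₀ < μ := hμ.lt_of_ne fun h => not_isSingular_aleph0 (h ▸ hsing)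
    exact max_lt h1 (mul_lt_of_lt hμ hαμ (hι.trans_lt hsing.cof_ord_lt))
  -- The index order has regular type τ, a successor cardinal above |α|·cf(μ). The strong limit
  -- property gives 2^(2^τ) < μ, which bounds the number of representatives.
  have hτ := isRegular_succ (le_max_left ℵ₀ (#α * #μ.ord.cof.ord.ToType))
  have hτμ := hlim.isSuccLimit.succ_lt hν
  have hW : Order.cof (Order.succ (max ℵ₀ (#α * #μ.ord.cof.ord.ToType))).ord.ToType =
      Order.succ (max ℵ₀ (#α * #μ.ord.cof.ord.ToType)) := by
    rw [Ordinal.cof_toType, hτ.cof_ord]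
  obtain ⟨f, hf⟩ := hα.exists_generating_partition hκ h0
    (W := (Order.succ (max ℵ₀ (#α * #μ.ord.cof.ord.ToType))).ord.ToType)
    (by rw [hW]; exact hτ.aleph0_le) (by rw [hW]; exact (le_max_right _ _).trans_lt (Order.lt_succ _))
    (by rw [mk_ord_toType]; exact (hlt2 (hlt2 hτμ)).trans (Order.lt_succ μ))
  refine reflects_of_generating_partition hμ ?_ hX hA ?_ (fun Y => f ⁻¹' Y) hf
    (fun δ hδ => ?_) hTstat
  · rw [Ordinal.cof_toType, hι, Ordinal.cof_ord_cof]
  · rw [mk_set, mk_set, mk_ord_toType]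
    exact (hlt2 (hlt2 hτμ)).le
  · rw [hι]
    exact (hT hδ).2
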